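/- Let $K,N,M\ge 1$ be integers. For $h:[N]\to\{\pm1\}$ let $|\psi_h\rangle=N^{-1/2}\sum_{x=1}^N h(x)|x\rangle$, and for $f:[M]\to\{\pm1\}$ let $\mathcal O_f=\sum_{i=1}^M f(i)|i\rangle\langle i|$. A one-query adversary (in normal form) is a triple $A=(M,V,\Pi)$ of the dimension $M$, an isometry $V:\mathbb C^N\to\mathbb C^M$ and an orthogonal projection $\Pi\in\mathbb C^{M\times M}$. With oracle access to $f$, it outputs $0$ on input $|\psi_h\rangle$ with probability $$p_A(h\mid f)=\langle\psi_h|V^\dagger\mathcal O_f\,\Pi\,\mathcal O_f V|\psi_h\rangle .$$ For a function family $R:[K]\times[N]\to\{\pm1\}$, with members $R_k=R(k,\cdot)$, its maximum distinguishing advantage is $$\Delta_A(R)=\max_{f:[M]\to\{\pm1\}}\Big|\mathop{\mathbb E}_{k\sim[K]}p_A(R_k\mid f)-\mathop{\mathbb E}_{h}\,p_A(h\mid f)\Big|,$$ where $k\in[K]$ and $h:[N]\to\{\pm1\}$ are uniformly random. **Theorem.** For every one-query adversary $A=(M,V,\Pi)$ and a uniformly random function family $R:[K]\times[N]\to\{\pm1\}$,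 $$\Pr_R\Big[\Delta_A(R)\ge \frac1{K^{1/4}}+4M\,e^{-K^{1/8}/2}\Big]\le 6KM\,e^{-K^{1/8}/32}.$$ The same bound holds, with $N=2^n$ and $M=2^m$, for every one-query oracle circuit $A=(n,m,\ell,U_1,U_2)$ with $m\ge1$, $n\le m$, $\ell\le m$ and $m$-qubit unitaries $U_1,U_2$. Given $f:\{0,1\}^\ell\to\{\pm1\}$ and an $n$-qubit input $|\psi\rangle$, the circuit prepares $U_2(\mathcal O_f\otimes\mathrm{Id})U_1(|\psi\rangle\otimes|0^{m-n}\rangle)$, where $\mathcal O_f$ acts on the first $\ell$ qubits, and outputs the result of measuring the first qubit in the standard basis. Here $p_A(h\mid f)$ is the probability that it outputs $0$ on $|\psi_h\rangle$, and the maximum in $\Delta_A(R)$ is over $f:\{0,1\}^\ell\to\{\pm1\}$. -/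

import Mathlib

open scoped BigOperators Matrix

noncomputable section

namespace OracleGame

/-- A sign, i.e. an element of `{1, -1}`, as a complex number. -/
def signC (s : ℤˣ) : ℂ := ((s : ℤ) : ℂ)

/-- The binary phase state `|ψ_h⟩ = N^{-1/2} ∑ x, h x |x⟩` of a Boolean function `h : X → {±1}`,
where `N` is the number of elements of `X`. -/
def phaseState {X : Type*} [Fintype X] (h : X → ℤˣ) : X → ℂ :=
  fun x => ((Real.sqrt (Fintype.card X) : ℝ) : ℂ)⁻¹ * signC (h x)

/-- The phase oracle `O_f = ∑ i, f i |i⟩⟨i|`. -/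
def phaseOracle {Y : Type*} [DecidableEq Y] (f : Y → ℤˣ) : Matrix Y Y ℂ :=
  Matrix.diagonal (fun i => signC (f i))

/-- The distinguishing advantage of an acceptance probability `p` on the function family `R`: the
absolute difference between the average of `p` over the `K` members of `R` and the average of `p`
over all Boolean functions `h : X → {±1}`. -/
def advantage {X : Type*} [Fintype X] [DecidableEq X] {K : ℕ}
    (p : (X → ℤˣ) → ℝ) (R : Fin K → X → ℤˣ) : ℝ :=
  |Finset.expect Finset.univ (fun k => p (R k)) - Finset.expect Finset.univ (fun h => p h)|

open scoped Classical in
/-- The probability of the event `E` under the uniform distribution on a finite type. -/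
def uniformProb {Ω : Type*} [Fintype Ω] (E : Ω → Prop) : ℝ :=
  ((Finset.univ.filter E).card : ℝ) / (Fintype.card Ω : ℝ)

/-- A one-query adversary in normal form: an isometry `V : ℂ^X → ℂ^Y`, applied before the query,
and an (orthogonal) projection `P` on `ℂ^Y`, measured after the query. -/
structure Adversary (X Y : Type*) [Fintype X] [DecidableEq X] [Fintype Y] where
  V : Matrix Y X ℂ
  isometry : Vᴴ * V = 1
  P : Matrix Y Y ℂ
  projection : IsStarProjection P

namespace Adversary

variable {X Y : Type*} [Fintype X] [DecidableEq X] [Fintype Y] [DecidableEq Y]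

/-- `p_A(h ∣ f) = ⟨ψ_h| V† O_f P O_f V |ψ_h⟩`, the probability that the adversary, given oracle
access to `f`, outputs `0` on `|ψ_h⟩`. (The right-hand side is a real number.) -/
def acceptProb (A : Adversary X Y) (f : Y → ℤˣ) (h : X → ℤˣ) : ℝ :=
  (star (phaseState h) ⬝ᵥ
    ((A.Vᴴ * phaseOracle f * A.P * phaseOracle f * A.V) *ᵥ phaseState h)).re

/-- The maximum distinguishing advantage `Δ_A(R)`, a maximum over the finitely many `f`. -/
def maxAdvantage (A : Adversary X Y) {K : ℕ} (R : Fin K → X → ℤˣ) : ℝ :=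
  ⨆ f : Y → ℤˣ, advantage (A.acceptProb f) R

end Adversary

/-- A one-query oracle circuit: an `n`-qubit input register inside `m ≥ 1` qubits, a query to a
phase oracle on the first `l` qubits, and `m`-qubit unitaries `U₁`, `U₂` before and after it.
The basis states of `q` qubits are indexed by the bit strings `Fin q → Bool`. -/
structure OneQueryCircuit (n m l : ℕ) where
  input_le : n ≤ m
  query_le : l ≤ m
  pos : 0 < m
  U₁ : Matrix (Fin m → Bool) (Fin m → Bool) ℂ
  U₁_unitary : U₁ ∈ Matrix.unitaryGroup (Fin m → Bool) ℂ
  U₂ : Matrix (Fin m → Bool) (Fin m → Bool) ℂ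
  U₂_unitary : U₂ ∈ Matrix.unitaryGroup (Fin m → Bool) ℂ

namespace OneQueryCircuit

variable {n m l : ℕ}

/-- The first `q` bits of an `m`-bit string. -/
def firstBits {q m : ℕ} (hq : q ≤ m) (z : Fin m → Bool) : Fin q → Bool :=
  fun i => z (Fin.castLE hq i)

/-- The state `|ψ⟩ ⊗ |0^{m-n}⟩`. -/
def withAncilla (A : OneQueryCircuit n m l) (ψ : (Fin n → Bool) → ℂ) : (Fin m → Bool) → ℂ :=
  fun z => if ∀ i : Fin m, n ≤ (i : ℕ) → z i = false then ψ (firstBits A.input_le z) else 0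

/-- The final state `U₂ (O_f ⊗ Id) U₁ (|ψ⟩ ⊗ |0^{m-n}⟩)`. -/
def finalState (A : OneQueryCircuit n m l) (f : (Fin l → Bool) → ℤˣ) (ψ : (Fin n → Bool) → ℂ) :
    (Fin m → Bool) → ℂ :=
  A.U₂ *ᵥ (phaseOracle (fun z => f (firstBits A.query_le z)) *ᵥ (A.U₁ *ᵥ A.withAncilla ψ))

/-- The probability that measuring the first qubit of the final state on input `|ψ_h⟩` gives `0`. -/
def acceptProb (A : OneQueryCircuit n m l) (f : (Fin l → Bool) → ℤˣ)
    (h : (Fin n → Bool) → ℤˣ) : ℝ :=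
  ∑ z : Fin m → Bool, if z ⟨0, A.pos⟩ = false then ‖A.finalState f (phaseState h) z‖ ^ 2 else 0

/-- The maximum distinguishing advantage `Δ_A(R)`, a maximum over the finitely many `f`. -/
def maxAdvantage (A : OneQueryCircuit n m l) {K : ℕ} (R : Fin K → (Fin n → Bool) → ℤˣ) : ℝ :=
  ⨆ f : (Fin l → Bool) → ℤˣ, advantage (A.acceptProb f) R

end OneQueryCircuit

end OracleGame

end

/-! A union bound over all $2^M$ oracles is too expensive, so the oracle is separated from the
randomness of $h$. Let $a_i(h)$ be the amplitudes of $V|\psi_h\rangle$ and $w_i$ the mean of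
$|a_i(h)|^2$ over $h$; the $w_i$ sum to 1. Then $p_A(h\mid f)=g_f^\dagger B_h g_f$, where
$g_f(i)=f(i)\sqrt{w_i}$ is a unit vector and $B_h=D_h^\dagger\Pi D_h$ with
$D_h=\mathrm{diag}(a_i(h)/\sqrt{w_i})$. The oracle enters only through a unit vector, so the
spectral norm of $\sum_k(B_{R_k}-\mathbb E B)$ controls every $f$ at once, and its tail costs a
factor $M$ instead of $2^M$.

The norm of $B_h$ is at most $L$ when $h$ is flat, i.e. $|a_i(h)|^2\le L w_i$ for all $i$. Each
$a_i$ is a Rademacher sum, so by Hoeffding flatness fails with probability at most $4Me^{-L/2}$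
(`uniformProb_not_flat_le`). Hence $B_h$ is replaced by 0 for other $h$, and `advantage_le` bounds
the resulting bias.

The matrix tail `uniformProb_quadForm_sum_ge_le` comes from trace moments by exchangeable pairs: one
summand is swapped with an independent copy, and a mean value inequality for traces bounds the
moment of order $2m+2$ by that of order $2m$. Circuits reduce to the normal form through
`toAdversary`. -/

namespace OracleGame

open Matrix

/-! ### Trace inequalities for Hermitian matrices. -/

section TraceInequalities

variable {ι : Type*} [Fintype ι]

/-- The squared Euclidean norm of a complex vector. -/
noncomputable def normSqVec (y : ι → ℂ) : ℝ := ∑ i, ‖y i‖ ^ 2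

lemma star_dotProduct_self (y : ι → ℂ) : star y ⬝ᵥ y = ((normSqVec y : ℝ) : ℂ) := by
  simp only [dotProduct, normSqVec, Pi.star_apply, RCLike.star_def, Complex.conj_mul']
  push_cast
  rfl

lemma re_trace_conjTranspose_mul_self (A : Matrix ι ι ℂ) :
    (Aᴴ * A).trace.re = ∑ j, normSqVec (fun i => A i j) := by
  simp [trace, mul_apply, normSqVec, ← Complex.normSq_eq_norm_sq, Complex.normSq_apply]

variable [DecidableEq ι]

/-- A power of a Hermitian matrix in its eigenbasis. -/
lemma IsHermitian.pow_eq {S : Matrix ι ι ℂ} (hS : S.IsHermitian) (p : ℕ) :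
    S ^ p = (hS.eigenvectorUnitary : Matrix ι ι ℂ) *
      diagonal (fun i => ((hS.eigenvalues i ^ p : ℝ) : ℂ)) *
        (hS.eigenvectorUnitary : Matrix ι ι ℂ)ᴴ := by
  conv_lhs => rw [hS.spectral_theorem]
  rw [← map_pow, diagonal_pow, Unitary.conjStarAlgAut_apply]
  congr 3
  ext i
  simp

/-- With eigenvectors $u_i$ of $S$ and $v_j$ of $T$, the weights are $|\langle u_i,v_j\rangle|^2$.
They do not depend on the exponents, so scalar inequalities in the eigenvalues transfer to traces
even if $S$ and $T$ do not commute. -/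
lemma trace_pow_mul_pow {S T : Matrix ι ι ℂ} (hS : S.IsHermitian) (hT : T.IsHermitian) :
    ∃ (w : ι → ι → ℝ) (a b : ι → ℝ), (∀ i j, 0 ≤ w i j) ∧
      ∀ p q : ℕ, (S ^ p * T ^ q).trace = ((∑ i, ∑ j, w i j * (a i ^ p * b j ^ q) : ℝ) : ℂ) := by
  set U : Matrix ι ι ℂ := ↑hS.eigenvectorUnitary with hU
  set V : Matrix ι ι ℂ := ↑hT.eigenvectorUnitary with hV
  refine ⟨fun i j => ‖(Uᴴ * V) i j‖ ^ 2, hS.eigenvalues, hT.eigenvalues,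
    fun i j => by positivity, fun p q => ?_⟩
  rw [IsHermitian.pow_eq hS, IsHermitian.pow_eq hT, ← hU, ← hV]
  set D := diagonal (fun i => ((hS.eigenvalues i ^ p : ℝ) : ℂ)) with hD
  set E := diagonal (fun i => ((hT.eigenvalues i ^ q : ℝ) : ℂ)) with hE
  have h1 : (U * D * Uᴴ * (V * E * Vᴴ)).trace = (D * (Uᴴ * V) * (E * (Uᴴ * V)ᴴ)).trace := by
    rw [conjTranspose_mul, conjTranspose_conjTranspose]
    rw [show U * D * Uᴴ * (V * E * Vᴴ) = U * (D * Uᴴ * (V * E * Vᴴ)) by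
      simp only [Matrix.mul_assoc], trace_mul_comm]
    simp only [Matrix.mul_assoc]
  rw [h1]
  push_cast
  refine Finset.sum_congr rfl fun i _ => ?_
  rw [diag_apply, mul_apply]
  refine Finset.sum_congr rfl fun j _ => ?_
  rw [hD, hE, diagonal_mul, diagonal_mul, conjTranspose_apply, RCLike.star_def,
    ← Complex.mul_conj']
  push_cast
  ring

/-- Factor $a^{2m+1}-b^{2m+1}$ as $(a-b)\sum_q a^q b^{2m-q}$ and pair $q$ with $2m-q$. Each pair is
at most $a^{2m}+b^{2m}$, because $|a|^q-|b|^q$ and $|a|^r-|b|^r$ never have opposite signs. -/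
lemma sub_mul_pow_sub_pow_le (a b : ℝ) (m : ℕ) :
    (a - b) * (a ^ (2 * m + 1) - b ^ (2 * m + 1)) ≤
      (2 * m + 1 : ℝ) / 2 * ((a - b) ^ 2 * (a ^ (2 * m) + b ^ (2 * m))) := by
  have key : ∀ q ∈ Finset.range (2 * m + 1),
      a ^ q * b ^ (2 * m - q) + a ^ (2 * m - q) * b ^ q ≤ a ^ (2 * m) + b ^ (2 * m) := by
    intro q hq
    have hq' : q ≤ 2 * m := by simpa [Nat.lt_succ_iff] using hq
    obtain ⟨r, hr⟩ := Nat.exists_eq_add_of_le hq'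
    have e1 : 2 * m - q = r := by omega
    have h0 : 0 ≤ (|a| ^ q - |b| ^ q) * (|a| ^ r - |b| ^ r) := by
      rcases le_total |a| |b| with h | h
      · exact mul_nonneg_of_nonpos_of_nonpos
          (sub_nonpos.2 (pow_le_pow_left₀ (abs_nonneg _) h _))
          (sub_nonpos.2 (pow_le_pow_left₀ (abs_nonneg _) h _))
      · exact mul_nonneg
          (sub_nonneg.2 (pow_le_pow_left₀ (abs_nonneg _) h _))
          (sub_nonneg.2 (pow_le_pow_left₀ (abs_nonneg _) h _))
    have ha : a ^ (2 * m) = |a| ^ q * |a| ^ r := by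
      rw [← pow_add, ← hr, pow_abs, abs_of_nonneg ((even_two_mul m).pow_nonneg _)]
    have hb : b ^ (2 * m) = |b| ^ q * |b| ^ r := by
      rw [← pow_add, ← hr, pow_abs, abs_of_nonneg ((even_two_mul m).pow_nonneg _)]
    have h1 : a ^ q * b ^ r ≤ |a| ^ q * |b| ^ r := by
      simpa [abs_mul] using le_abs_self (a ^ q * b ^ r)
    have h2 : a ^ r * b ^ q ≤ |a| ^ r * |b| ^ q := by
      simpa [abs_mul] using le_abs_self (a ^ r * b ^ q)
    rw [e1, ha, hb]
    nlinarith
  have hsum := Finset.sum_le_sum key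
  rw [Finset.sum_add_distrib, Finset.sum_const, Finset.card_range, nsmul_eq_mul] at hsum
  have hrefl : ∑ q ∈ Finset.range (2 * m + 1), a ^ (2 * m - q) * b ^ q =
      ∑ q ∈ Finset.range (2 * m + 1), a ^ q * b ^ (2 * m - q) := by
    rw [← Finset.sum_range_reflect]
    refine Finset.sum_congr rfl fun q hq => ?_
    have hq' : q ≤ 2 * m := by simpa [Nat.lt_succ_iff] using hq
    grind
  have hg := (Commute.all a b).mul_geom_sum₂ (2 * m + 1)
  simp only [add_tsub_cancel_right] at hg
  rw [hrefl] at hsum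
  rw [← hg]
  push_cast at hsum
  nlinarith [mul_le_mul_of_nonneg_left hsum (sq_nonneg (a - b))]

/-- The mean value trace inequality for odd powers. -/
lemma re_trace_sub_mul_pow_sub_pow_le {S T : Matrix ι ι ℂ} (hS : S.IsHermitian)
    (hT : T.IsHermitian) (m : ℕ) :
    ((S - T) * (S ^ (2 * m + 1) - T ^ (2 * m + 1))).trace.re ≤
      (2 * m + 1 : ℝ) / 2 *
        (((S - T) ^ 2 * S ^ (2 * m)).trace.re + ((S - T) ^ 2 * T ^ (2 * m)).trace.re) := by
  obtain ⟨w, a, b, hw, h⟩ := trace_pow_mul_pow hS hT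
  -- Cyclicity of the trace brings every word that occurs into the form $S^pT^q$, the only one
  -- covered by `h`.
  have e1 : ((S - T) * (S ^ (2 * m + 1) - T ^ (2 * m + 1))).trace =
      (S ^ (2 * m + 2) * T ^ 0).trace - (S ^ 1 * T ^ (2 * m + 1)).trace -
        (S ^ (2 * m + 1) * T ^ 1).trace + (S ^ 0 * T ^ (2 * m + 2)).trace := by
    rw [trace_mul_comm (S ^ (2 * m + 1)), ← trace_sub, ← trace_sub, ← trace_add]
    congr 1
    simp only [pow_zero, pow_one, mul_one, one_mul, pow_succ' _ (2 * m + 1)]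
    noncomm_ring
  have e2 : ((S - T) ^ 2 * S ^ (2 * m)).trace =
      (S ^ (2 * m + 2) * T ^ 0).trace - (S ^ (2 * m + 1) * T ^ 1).trace -
        (S ^ (2 * m + 1) * T ^ 1).trace + (S ^ (2 * m) * T ^ 2).trace := by
    have c1 : (S ^ (2 * m + 1) * T ^ 1).trace = (S * T * S ^ (2 * m)).trace := by
      rw [Matrix.mul_assoc, trace_mul_comm S, Matrix.mul_assoc, trace_mul_comm T, pow_one,
        pow_succ]
    have c2 : (S ^ (2 * m + 1) * T ^ 1).trace = (T * S * S ^ (2 * m)).trace := by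
      rw [trace_mul_comm, Matrix.mul_assoc, pow_one, pow_succ']
    have c3 : (S ^ (2 * m + 2) * T ^ 0).trace = (S * S * S ^ (2 * m)).trace := by
      rw [pow_zero, mul_one, pow_succ', pow_succ', Matrix.mul_assoc]
    rw [trace_mul_comm (S ^ (2 * m)), c3]
    nth_rw 1 [c1]
    rw [c2, ← trace_sub, ← trace_sub, ← trace_add]
    congr 1
    noncomm_ring
  have e3 : ((S - T) ^ 2 * T ^ (2 * m)).trace =
      (S ^ 2 * T ^ (2 * m)).trace - (S ^ 1 * T ^ (2 * m + 1)).trace -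
        (S ^ 1 * T ^ (2 * m + 1)).trace + (S ^ 0 * T ^ (2 * m + 2)).trace := by
    have c1 : (S ^ 1 * T ^ (2 * m + 1)).trace = (T * S * T ^ (2 * m)).trace := by
      rw [Matrix.mul_assoc, trace_mul_comm T, Matrix.mul_assoc, pow_one, pow_succ]
    have c2 : (S ^ 1 * T ^ (2 * m + 1)).trace = (S * T * T ^ (2 * m)).trace := by
      rw [Matrix.mul_assoc, pow_one, pow_succ']
    have c3 : (S ^ 0 * T ^ (2 * m + 2)).trace = (T * T * T ^ (2 * m)).trace := by
      rw [pow_zero, one_mul, pow_succ', pow_succ', Matrix.mul_assoc]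
    rw [c3]
    nth_rw 1 [c1]
    rw [c2, ← trace_sub, ← trace_sub, ← trace_add]
    congr 1
    noncomm_ring
  rw [e1, e2, e3]
  simp only [h, ← Complex.ofReal_sub, ← Complex.ofReal_add, Complex.ofReal_re,
    ← Finset.sum_sub_distrib, ← Finset.sum_add_distrib, Finset.mul_sum]
  refine Finset.sum_le_sum fun i _ => Finset.sum_le_sum fun j _ => ?_
  have := mul_le_mul_of_nonneg_left (sub_mul_pow_sub_pow_le (a i) (b j) m) (hw i j)
  calc _ = w i j * ((a i - b j) * (a i ^ (2 * m + 1) - b j ^ (2 * m + 1))) := by ring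
    _ ≤ _ := this
    _ = _ := by ring

lemma re_trace_even_pow {S : Matrix ι ι ℂ} (hS : S.IsHermitian) (m : ℕ) :
    (S ^ (2 * m)).trace.re = ∑ j, normSqVec (fun i => (S ^ m) i j) := by
  rw [← re_trace_conjTranspose_mul_self, conjTranspose_pow, hS.eq, ← pow_add, two_mul]

lemma re_trace_sq_mul_even_pow_le {D S : Matrix ι ι ℂ} (hD : D.IsHermitian) (hS : S.IsHermitian)
    {c : ℝ} (hc : ∀ y, normSqVec (D *ᵥ y) ≤ c * normSqVec y) (m : ℕ) :
    (D ^ 2 * S ^ (2 * m)).trace.re ≤ c * (S ^ (2 * m)).trace.re := by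
  have e : (D ^ 2 * S ^ (2 * m)).trace = ((D * S ^ m)ᴴ * (D * S ^ m)).trace := by
    rw [conjTranspose_mul, conjTranspose_pow, hS.eq, hD.eq, two_mul, pow_add, ← Matrix.mul_assoc,
      trace_mul_comm, sq]
    simp only [Matrix.mul_assoc]
  rw [e, re_trace_conjTranspose_mul_self, re_trace_even_pow hS, Finset.mul_sum]
  refine Finset.sum_le_sum fun j _ => ?_
  exact hc fun i => (S ^ m) i j

/-- A quadratic form is dominated by the Schatten norms. -/
lemma re_quadForm_pow_le_trace {S : Matrix ι ι ℂ} (hS : S.IsHermitian) (g : ι → ℂ)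
    (hg : normSqVec g = 1) (m : ℕ) :
    (star g ⬝ᵥ (S *ᵥ g)).re ^ (2 * m) ≤ (S ^ (2 * m)).trace.re := by
  set U : Matrix ι ι ℂ := ↑hS.eigenvectorUnitary with hU
  have hUU : U * Uᴴ = 1 := Unitary.coe_mul_star_self hS.eigenvectorUnitary
  have hUU' : Uᴴ * U = 1 := Unitary.coe_star_mul_self hS.eigenvectorUnitary
  set y := Uᴴ *ᵥ g with hy
  have hstar : star y = star g ᵥ* U := by
    rw [hy, star_mulVec, conjTranspose_conjTranspose]
  have hyn : normSqVec y = 1 := by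
    have := star_dotProduct_self y
    rw [hstar, hy, ← dotProduct_mulVec, mulVec_mulVec, hUU, one_mulVec, star_dotProduct_self,
      hg] at this
    exact_mod_cast this.symm
  have hq : (star g ⬝ᵥ (S *ᵥ g)).re = ∑ i, ‖y i‖ ^ 2 * hS.eigenvalues i := by
    have h1 := IsHermitian.pow_eq hS 1
    rw [pow_one, ← hU] at h1
    have h2 : S *ᵥ g = _ := congrArg (· *ᵥ g) h1
    rw [h2, Matrix.mul_assoc, ← mulVec_mulVec, dotProduct_mulVec, ← hstar, ← mulVec_mulVec, ← hy]
    simp only [dotProduct, mulVec_diagonal, Complex.re_sum, pow_one]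
    refine Finset.sum_congr rfl fun i _ => ?_
    rw [mul_left_comm, Pi.star_apply, RCLike.star_def, Complex.conj_mul', ← Complex.ofReal_pow,
      ← Complex.ofReal_mul, Complex.ofReal_re, mul_comm]
  have ht : (S ^ (2 * m)).trace.re = ∑ i, hS.eigenvalues i ^ (2 * m) := by
    rw [IsHermitian.pow_eq hS, ← hU, Matrix.mul_assoc, trace_mul_comm, Matrix.mul_assoc, hUU',
      mul_one, trace_diagonal, Complex.re_sum]
    rfl
  rw [hq, ht]
  -- Jensen for the even power: the $|y_i|^2$ are probability weights on the spectrum. Afterwards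
  -- each weight is bounded by 1.
  refine (Real.pow_arith_mean_le_arith_mean_pow_of_even _ _ _ (fun i _ => by positivity) hyn
    (even_two_mul m)).trans (Finset.sum_le_sum fun i _ => ?_)
  have h0 : 0 ≤ hS.eigenvalues i ^ (2 * m) := (even_two_mul m).pow_nonneg _
  have h1 : ‖y i‖ ^ 2 ≤ 1 := by
    rw [← hyn]
    exact Finset.single_le_sum (f := fun i => ‖y i‖ ^ 2) (fun _ _ => by positivity)
      (Finset.mem_univ i)
  nlinarith

end TraceInequalities

/-! ### Swapping a coordinate with an independent copy. -/

section Swap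

variable {κ H : Type*} [Fintype κ] [DecidableEq κ] [Fintype H]

/-- Exchanging one coordinate of a function with an independent copy. -/
lemma sum_sum_update {β : Type*} [AddCommMonoid β] (k : κ) (G : (κ → H) → H → β) :
    ∑ R, ∑ h, G (Function.update R k h) (R k) = ∑ R, ∑ h, G R h := by
  rw [← Fintype.sum_prod_type', ← Fintype.sum_prod_type']
  have hinv : Function.Involutive
      (fun p : (κ → H) × H => ((Function.update p.1 k p.2, p.1 k) : (κ → H) × H)) := by
    rintro ⟨R, h⟩
    simp
  exact Fintype.sum_equiv hinv.toPerm _ _ fun _ => rfl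

lemma card_mul_sum_apply (k : κ) (F : H → ℝ) :
    (Fintype.card H : ℝ) * ∑ R : κ → H, F (R k) = Fintype.card (κ → H) * ∑ h, F h := by
  have := sum_sum_update k (fun (_ : κ → H) h => F h)
  simpa [Finset.mul_sum] using this

end Swap

/-! ### Elementary probability on finite types. -/

section UniformProb

variable {Ω : Type*} [Fintype Ω]

open scoped Classical in
lemma uniformProb_eq_sum (E : Ω → Prop) :
    uniformProb E = (∑ ω, if E ω then (1 : ℝ) else 0) / Fintype.card Ω := by
  rw [uniformProb, Finset.sum_boole]

lemma uniformProb_mono {E F : Ω → Prop} (h : ∀ ω, E ω → F ω) : uniformProb E ≤ uniformProb F := by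
  classical
  unfold uniformProb
  gcongr
  intro h'
  exact h _ h'

lemma uniformProb_le_one (E : Ω → Prop) : uniformProb E ≤ 1 := by
  classical
  unfold uniformProb
  refine div_le_one_of_le₀ ?_ (by positivity)
  exact_mod_cast Finset.card_le_univ _

lemma uniformProb_or_le (E F : Ω → Prop) :
    uniformProb (fun ω => E ω ∨ F ω) ≤ uniformProb E + uniformProb F := by
  classical
  simp only [uniformProb_eq_sum]
  rw [← add_div, ← Finset.sum_add_distrib]
  gcongr with ω
  by_cases hE : E ω <;> by_cases hF : F ω <;> simp [hE, hF]

lemma uniformProb_exists_le {α : Type*} [Fintype α] (E : α → Ω → Prop) :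
    uniformProb (fun ω => ∃ i, E i ω) ≤ ∑ i, uniformProb (E i) := by
  classical
  simp only [uniformProb_eq_sum]
  rw [← Finset.sum_div, Finset.sum_comm]
  gcongr with ω
  split_ifs with h
  · obtain ⟨i, hi⟩ := h
    have := Finset.single_le_sum (f := fun i => if E i ω then (1 : ℝ) else 0)
      (fun j _ => by positivity) (Finset.mem_univ i)
    simpa [hi] using this
  · exact Finset.sum_nonneg fun j _ => by positivity

/-- Markov's inequality. -/
lemma uniformProb_le_of_sum_le {F : Ω → ℝ} (hF : ∀ ω, 0 ≤ F ω) {t b : ℝ} (ht : 0 < t)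
    (hb : ∑ ω, F ω ≤ Fintype.card Ω * b) (hb0 : 0 ≤ b) :
    uniformProb (fun ω => t ≤ F ω) ≤ b / t := by
  classical
  rw [uniformProb_eq_sum]
  have h : t * ∑ ω, (if t ≤ F ω then (1 : ℝ) else 0) ≤ Fintype.card Ω * b := by
    refine le_trans ?_ hb
    rw [Finset.mul_sum]
    refine Finset.sum_le_sum fun ω _ => ?_
    split_ifs with h
    · simpa using h
    · simpa using hF ω
  refine div_le_of_le_mul₀ (by positivity) (by positivity) ?_
  rw [div_mul_eq_mul_div, le_div_iff₀ ht]
  linarith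

lemma uniformProb_apply {κ : Type*} [Fintype κ] [DecidableEq κ] [Nonempty Ω] (k : κ)
    (E : Ω → Prop) : uniformProb (fun R : κ → Ω => E (R k)) = uniformProb E := by
  classical
  have h := card_mul_sum_apply (κ := κ) k (fun ω : Ω => if E ω then (1 : ℝ) else 0)
  have h1 : (Fintype.card Ω : ℝ) ≠ 0 := by positivity
  have h2 : (Fintype.card (κ → Ω) : ℝ) ≠ 0 := by
    exact_mod_cast Fintype.card_ne_zero
  simp only [uniformProb_eq_sum]
  rw [div_eq_div_iff h2 h1]
  linarith

end UniformProb

/-! ### Tails of Rademacher sums. -/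

section Rademacher

variable {X : Type*} [Fintype X] [DecidableEq X]

lemma sum_exp_rademacher_le (a : X → ℝ) :
    ∑ h : X → ℤˣ, Real.exp (∑ x, a x * ((h x : ℤ) : ℝ)) ≤
      Fintype.card (X → ℤˣ) * Real.exp ((∑ x, a x ^ 2) / 2) := by
  have h1 : ∑ h : X → ℤˣ, Real.exp (∑ x, a x * ((h x : ℤ) : ℝ)) = ∏ x, (2 * Real.cosh (a x)) := by
    simp only [Real.exp_sum]
    rw [← Fintype.prod_sum (fun x (s : ℤˣ) => Real.exp (a x * ((s : ℤ) : ℝ)))]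
    refine Finset.prod_congr rfl fun x _ => ?_
    rw [UnitsInt.univ, Finset.sum_pair (by decide), Real.cosh_eq]
    simp
    ring
  rw [h1, Finset.prod_mul_distrib, Finset.sum_div, Real.exp_sum]
  have h2 : (Fintype.card (X → ℤˣ) : ℝ) = ∏ _x : X, (2 : ℝ) := by simp
  rw [h2]
  gcongr with x
  exact Real.cosh_le_exp_half_sq _

/-- The two-sided Hoeffding bound for Rademacher sums. -/
lemma uniformProb_rademacher_sq_le (a : X → ℝ) {x : ℝ} (hx : 0 ≤ x) :
    uniformProb (fun h : X → ℤˣ => x * ∑ y, a y ^ 2 < (∑ y, a y * ((h y : ℤ) : ℝ)) ^ 2) ≤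
      2 * Real.exp (-x / 2) := by
  set v := ∑ y, a y ^ 2 with hv
  have hv0 : 0 ≤ v := Finset.sum_nonneg fun _ _ => sq_nonneg _
  -- The optimal Chernoff parameter: the exponential moment is at most $e^{x/2}$ against the
  -- threshold $e^x$. If $v=0$, division by zero gives $l=0$; the strict inequality in the event
  -- then rules this case out.
  set l := Real.sqrt (x / v) with hl
  have hsum : ∀ e : ℝ, e ^ 2 = 1 → uniformProb (fun h : X → ℤˣ =>
      Real.exp x ≤ Real.exp (∑ y, (e * l * a y) * ((h y : ℤ) : ℝ))) ≤ Real.exp (-x / 2) := by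
    intro e he
    refine (uniformProb_le_of_sum_le (fun _ => (Real.exp_pos _).le) (Real.exp_pos _)
      (sum_exp_rademacher_le fun y => e * l * a y) (Real.exp_pos _).le).trans ?_
    rw [← Real.exp_sub, Real.exp_le_exp]
    have h1 : ∑ y, (e * l * a y) ^ 2 = x / v * v := by
      rw [hv, Finset.mul_sum, ← hv]
      refine Finset.sum_congr rfl fun y _ => ?_
      rw [mul_pow, mul_pow, he, hl, Real.sq_sqrt (by positivity), one_mul]
    have h2 : x / v * v ≤ x := by
      rcases eq_or_ne v 0 with h | h
      · simpa [h] using hx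
      · rw [div_mul_cancel₀ _ h]
    rw [h1]
    linarith
  rw [two_mul]
  refine le_trans ?_ (add_le_add (hsum 1 (by norm_num)) (hsum (-1) (by norm_num)))
  refine (uniformProb_mono fun h hh => ?_).trans (uniformProb_or_le _ _)
  have hv1 : 0 < v := by
    refine lt_of_le_of_ne hv0 fun h0 => ?_
    have h3 : ∀ y, a y = 0 := by
      intro y
      have := (Finset.sum_eq_zero_iff_of_nonneg (fun y _ => sq_nonneg (a y))).1 (hv ▸ h0.symm) y
        (Finset.mem_univ y)
      simpa using this
    rw [← h0] at hh
    simp [h3] at hh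
  have e1 : ∀ e : ℝ, ∑ y, (e * l * a y) * ((h y : ℤ) : ℝ) =
      e * (l * ∑ y, a y * ((h y : ℤ) : ℝ)) := by
    intro e
    simp only [Finset.mul_sum, mul_assoc]
  simp only [Real.exp_le_exp, e1]
  set s := ∑ y, a y * ((h y : ℤ) : ℝ)
  have h4 : x ≤ |l * s| := by
    refine (sq_le_sq₀ hx (abs_nonneg _)).1 ?_
    rw [sq_abs, mul_pow, hl, Real.sq_sqrt (by positivity), div_mul_eq_mul_div, le_div_iff₀ hv1]
    nlinarith
  rcases le_abs.1 h4 with h5 | h5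
  · left; linarith
  · right; linarith

end Rademacher

/-! ### Moments and tails of sums of independent random matrices. -/

section MatrixConcentration

variable {ι κ H : Type*} [Fintype ι] [DecidableEq ι] [Fintype κ] [DecidableEq κ] [Fintype H]

lemma isHermitian_sum_apply {ι κ H : Type*} [Fintype κ] {X : H → Matrix ι ι ℂ} (hX : ∀ h, (X h).IsHermitian) (R : κ → H) :
    (∑ k, X (R k)).IsHermitian := by
  rw [IsHermitian, conjTranspose_sum]
  exact Finset.sum_congr rfl fun k _ => (hX _).eq

/-- One step of the recursion for the trace moments of a sum of independent centered random
matrices. -/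
lemma sum_trace_pow_succ_le [Nonempty H] {X : H → Matrix ι ι ℂ} (hX : ∀ h, (X h).IsHermitian)
    (h0 : ∑ h, X h = 0) {c : ℝ}
    (hc : ∀ h h' y, normSqVec ((X h - X h') *ᵥ y) ≤ c * normSqVec y) (m : ℕ) :
    ∑ R : κ → H, ((∑ k, X (R k)) ^ (2 * (m + 1))).trace.re ≤
      (2 * m + 1 : ℝ) / 2 * c * Fintype.card κ *
        ∑ R : κ → H, ((∑ k, X (R k)) ^ (2 * m)).trace.re := by
  set S : (κ → H) → Matrix ι ι ℂ := fun R => ∑ k, X (R k) with hS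
  have hSh : ∀ R, (S R).IsHermitian := fun R => isHermitian_sum_apply hX R
  have hcard : (0 : ℝ) < Fintype.card H := by positivity
  have hstep : ∀ k : κ, ∑ R : κ → H, (X (R k) * S R ^ (2 * m + 1)).trace.re ≤
      (2 * m + 1 : ℝ) / 2 * c * ∑ R : κ → H, (S R ^ (2 * m)).trace.re := by
    intro k
    set G : (κ → H) → H → ℝ := fun R h => ((X (R k) - X h) * S R ^ (2 * m + 1)).trace.re with hG
    have hsub : ∀ R h, S R - S (Function.update R k h) = X (R k) - X h := by
      intro R h
      simp only [hS]
      rw [← Finset.sum_sub_distrib, Finset.sum_eq_single k]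
      · simp
      · intro j _ hj
        simp [hj]
      · simp
    -- The independent copy $X_h$ can be subtracted for free, because the $X_h$ sum to zero.
    have ha : ∑ R, ∑ h, G R h =
        Fintype.card H * ∑ R : κ → H, (X (R k) * S R ^ (2 * m + 1)).trace.re := by
      rw [Finset.mul_sum]
      refine Finset.sum_congr rfl fun R _ => ?_
      have : ∑ h, (X h * S R ^ (2 * m + 1)).trace.re = 0 := by
        rw [← Complex.re_sum, ← trace_sum, ← Finset.sum_mul, h0, zero_mul, trace_zero,
          Complex.zero_re]
      simp only [hG, sub_mul, trace_sub, Complex.sub_re]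
      rw [Finset.sum_sub_distrib, this]
      simp
    -- Averaging $G$ with its swapped version turns the summand into $(S-S')(S^{2m+1}-S'^{2m+1})$,
    -- to which the mean value trace inequality applies.
    have hb := sum_sum_update k G
    have hpt : ∀ R h, G R h + G (Function.update R k h) (R k) ≤ (2 * m + 1 : ℝ) / 2 * c *
        ((S R ^ (2 * m)).trace.re + (S (Function.update R k h) ^ (2 * m)).trace.re) := by
      intro R h
      have hm := re_trace_sub_mul_pow_sub_pow_le (hSh R) (hSh (Function.update R k h)) m
      rw [hsub] at hm
      have hD : (X (R k) - X h).IsHermitian := (hX _).sub (hX _)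
      have b1 := re_trace_sq_mul_even_pow_le hD (hSh R) (hc _ _) m
      have b2 := re_trace_sq_mul_even_pow_le hD (hSh (Function.update R k h)) (hc _ _) m
      have e : G R h + G (Function.update R k h) (R k) =
          ((X (R k) - X h) * (S R ^ (2 * m + 1) -
            S (Function.update R k h) ^ (2 * m + 1))).trace.re := by
        simp only [hG, Function.update_self]
        rw [← Complex.add_re, ← trace_add]
        congr 2
        noncomm_ring
      rw [e]
      refine hm.trans ?_
      rw [mul_assoc ((2 * m + 1 : ℝ) / 2) c]
      refine mul_le_mul_of_nonneg_left ?_ (by positivity)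
      linarith
    have hsum := Finset.sum_le_sum fun R (_ : R ∈ Finset.univ) =>
      Finset.sum_le_sum fun h (_ : h ∈ Finset.univ) => hpt R h
    simp only [Finset.sum_add_distrib, ← Finset.mul_sum] at hsum
    rw [hb, ha, sum_sum_update k (fun R _ => (S R ^ (2 * m)).trace.re)] at hsum
    simp only [Finset.sum_const, Finset.card_univ, nsmul_eq_mul, ← Finset.mul_sum] at hsum
    nlinarith
  have hexp : ∀ R : κ → H, (S R ^ (2 * (m + 1))).trace.re =
      ∑ k, (X (R k) * S R ^ (2 * m + 1)).trace.re := by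
    intro R
    rw [show 2 * (m + 1) = 2 * m + 1 + 1 by ring, pow_succ', ← Complex.re_sum, ← trace_sum,
      ← Finset.sum_mul]
  calc ∑ R, (S R ^ (2 * (m + 1))).trace.re
      = ∑ k, ∑ R : κ → H, (X (R k) * S R ^ (2 * m + 1)).trace.re := by
        rw [Finset.sum_comm]
        exact Finset.sum_congr rfl fun R _ => hexp R
    _ ≤ ∑ _k : κ, (2 * m + 1 : ℝ) / 2 * c * ∑ R : κ → H, (S R ^ (2 * m)).trace.re :=
        Finset.sum_le_sum fun k _ => hstep k
    _ = _ := by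
        rw [Finset.sum_const, Finset.card_univ, nsmul_eq_mul]
        ring

/-- The recursion is iterated with $p$ fixed: every factor $(2m+1)/2$ with $m<p$ is at most $p$. -/
lemma sum_trace_pow_le [Nonempty H] {X : H → Matrix ι ι ℂ} (hX : ∀ h, (X h).IsHermitian)
    (h0 : ∑ h, X h = 0) {c : ℝ} (hc0 : 0 ≤ c)
    (hc : ∀ h h' y, normSqVec ((X h - X h') *ᵥ y) ≤ c * normSqVec y) (p : ℕ) :
    ∑ R : κ → H, ((∑ k, X (R k)) ^ (2 * p)).trace.re ≤
      Fintype.card (κ → H) * (Fintype.card ι * (p * c * Fintype.card κ) ^ p) := by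
  have key : ∀ m ≤ p, ∑ R : κ → H, ((∑ k, X (R k)) ^ (2 * m)).trace.re ≤
      Fintype.card (κ → H) * (Fintype.card ι * (p * c * Fintype.card κ) ^ m) := by
    intro m
    induction m with
    | zero => intro _; simp
    | succ m ih =>
      intro hm
      have hmp : (m : ℝ) + 1 ≤ p := by exact_mod_cast hm
      refine (sum_trace_pow_succ_le hX h0 hc m).trans ?_
      have hp : (2 * m + 1 : ℝ) / 2 * c * Fintype.card κ ≤ p * c * Fintype.card κ := by
        gcongr
        linarith
      calc _ ≤ (2 * m + 1 : ℝ) / 2 * c * Fintype.card κ *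
            (Fintype.card (κ → H) * (Fintype.card ι * (p * c * Fintype.card κ) ^ m)) := by
            gcongr
            exact ih (by omega)
        _ ≤ p * c * Fintype.card κ *
            (Fintype.card (κ → H) * (Fintype.card ι * (p * c * Fintype.card κ) ^ m)) := by
            gcongr
        _ = _ := by ring
  exact key p le_rfl

/-- A tail bound, linear in the dimension, for the quadratic forms of a sum of independent
centered random matrices. -/
lemma uniformProb_quadForm_sum_ge_le [Nonempty H] {X : H → Matrix ι ι ℂ}
    (hX : ∀ h, (X h).IsHermitian) (h0 : ∑ h, X h = 0) {c : ℝ} (hc0 : 0 ≤ c)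
    (hc : ∀ h h' y, normSqVec ((X h - X h') *ᵥ y) ≤ c * normSqVec y) (p : ℕ) {t : ℝ}
    (ht : 0 < t) :
    uniformProb (fun R : κ → H => ∃ g, normSqVec g = 1 ∧
        t ≤ |(star g ⬝ᵥ ((∑ k, X (R k)) *ᵥ g)).re|) ≤
      Fintype.card ι * (p * c * Fintype.card κ / t ^ 2) ^ p := by
  refine (uniformProb_mono fun R hR => ?_).trans ((uniformProb_le_of_sum_le (t := t ^ (2 * p))
    (F := fun R : κ → H => ((∑ k, X (R k)) ^ (2 * p)).trace.re)
    (b := Fintype.card ι * (p * c * Fintype.card κ) ^ p) (fun R => ?_) (by positivity)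
    (sum_trace_pow_le hX h0 hc0 hc p) (by positivity)).trans_eq ?_)
  · obtain ⟨g, hg, hR⟩ := hR
    refine le_trans ?_ (re_quadForm_pow_le_trace (isHermitian_sum_apply hX R) g hg p)
    exact (pow_le_pow_left₀ ht.le hR _).trans_eq ((even_two_mul p).pow_abs _)
  · rw [re_trace_even_pow (isHermitian_sum_apply hX R)]
    exact Finset.sum_nonneg fun _ _ => Finset.sum_nonneg fun _ _ => by positivity
  · rw [pow_mul, div_pow, mul_div_assoc]

end MatrixConcentration

/-! ### Norms, projections and diagonal compressions. -/

section Vectors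

variable {ι : Type*} [Fintype ι]

lemma normSqVec_nonneg (y : ι → ℂ) : 0 ≤ normSqVec y :=
  Finset.sum_nonneg fun _ _ => by positivity

lemma normSqVec_sub_le (y z : ι → ℂ) :
    normSqVec (y - z) ≤ 2 * normSqVec y + 2 * normSqVec z := by
  simp only [normSqVec, Finset.mul_sum, ← Finset.sum_add_distrib]
  refine Finset.sum_le_sum fun i _ => ?_
  have h := norm_sub_le (y i) (z i)
  have h0 := norm_nonneg ((y - z) i)
  rw [Pi.sub_apply] at *
  nlinarith [sq_nonneg (‖y i‖ - ‖z i‖)]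

lemma normSqVec_mul_le {d : ι → ℂ} {L : ℝ} (hd : ∀ i, ‖d i‖ ^ 2 ≤ L) (y : ι → ℂ) :
    normSqVec (fun i => d i * y i) ≤ L * normSqVec y := by
  simp only [normSqVec, Finset.mul_sum, norm_mul, mul_pow]
  exact Finset.sum_le_sum fun i _ => mul_le_mul_of_nonneg_right (hd i) (by positivity)

lemma norm_signC (s : ℤˣ) : ‖signC s‖ = 1 := by
  rcases Int.units_eq_one_or s with rfl | rfl <;> simp [signC]

lemma normSqVec_signC_mul (f : ι → ℤˣ) (y : ι → ℂ) :
    normSqVec (fun i => signC (f i) * y i) = normSqVec y := by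
  simp [normSqVec, norm_signC]

lemma normSqVec_phaseState [Nonempty ι] (h : ι → ℤˣ) : normSqVec (phaseState h) = 1 := by
  have hc : (Fintype.card ι : ℝ) ≠ 0 := by positivity
  simp [normSqVec, phaseState, norm_signC, hc]

lemma normSqVec_mulVec_of_isometry {κ : Type*} [Fintype κ] [DecidableEq κ] {V : Matrix ι κ ℂ}
    (hV : Vᴴ * V = 1) (y : κ → ℂ) : normSqVec (V *ᵥ y) = normSqVec y := by
  have h := star_dotProduct_self (V *ᵥ y)
  rw [star_mulVec, dotProduct_mulVec, vecMul_vecMul, hV, vecMul_one, star_dotProduct_self] at h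
  exact_mod_cast h.symm

lemma normSqVec_mulVec_of_isStarProjection {P : Matrix ι ι ℂ} (hP : IsStarProjection P)
    (y : ι → ℂ) : normSqVec (P *ᵥ y) = (star y ⬝ᵥ (P *ᵥ y)).re := by
  have h := star_dotProduct_self (P *ᵥ y)
  have hs : Pᴴ = P := hP.isSelfAdjoint
  rw [star_mulVec, ← dotProduct_mulVec, mulVec_mulVec, hs, hP.isIdempotentElem.eq] at h
  rw [h, Complex.ofReal_re]

/-- The difference of the two sides is the squared norm of $(1-P)y$. -/
lemma re_quadForm_le_of_isStarProjection [DecidableEq ι] {P : Matrix ι ι ℂ}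
    (hP : IsStarProjection P) (y : ι → ℂ) : (star y ⬝ᵥ (P *ᵥ y)).re ≤ normSqVec y := by
  have h := normSqVec_mulVec_of_isStarProjection hP.one_sub y
  rw [sub_mulVec, one_mulVec, dotProduct_sub, star_dotProduct_self, Complex.sub_re,
    Complex.ofReal_re] at h
  have := normSqVec_nonneg (y - P *ᵥ y)
  linarith

/-- The compression `D(d)† P D(d)` of `P` by a diagonal matrix. -/
def scaledProj [DecidableEq ι] (P : Matrix ι ι ℂ) (d : ι → ℂ) : Matrix ι ι ℂ :=
  (diagonal d)ᴴ * (P * diagonal d)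

variable [DecidableEq ι]

lemma isHermitian_scaledProj {P : Matrix ι ι ℂ} (hP : IsStarProjection P) (d : ι → ℂ) :
    (scaledProj P d).IsHermitian := by
  have hs : Pᴴ = P := hP.isSelfAdjoint
  rw [IsHermitian, scaledProj, conjTranspose_mul, conjTranspose_mul, conjTranspose_conjTranspose,
    hs, Matrix.mul_assoc]

lemma quadForm_scaledProj (P : Matrix ι ι ℂ) (d g : ι → ℂ) :
    star g ⬝ᵥ (scaledProj P d *ᵥ g) =
      star (fun i => d i * g i) ⬝ᵥ (P *ᵥ (fun i => d i * g i)) := by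
  have h : (fun i => d i * g i) = diagonal d *ᵥ g := by
    ext i
    rw [mulVec_diagonal]
  rw [h, star_mulVec, ← dotProduct_mulVec, mulVec_mulVec, mulVec_mulVec, scaledProj,
    Matrix.mul_assoc]

/-- Each of the two diagonal factors contributes one $L$ to the squared norm, and $P$ is a
contraction. -/
lemma normSqVec_scaledProj_mulVec_le {P : Matrix ι ι ℂ} (hP : IsStarProjection P) {d : ι → ℂ}
    {L : ℝ} (hL : 0 ≤ L) (hd : ∀ i, ‖d i‖ ^ 2 ≤ L) (y : ι → ℂ) :
    normSqVec (scaledProj P d *ᵥ y) ≤ L ^ 2 * normSqVec y := by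
  have h1 : scaledProj P d *ᵥ y = fun i => star (d i) * (P *ᵥ (fun i => d i * y i)) i := by
    have h : (fun i => d i * y i) = diagonal d *ᵥ y := by
      ext i
      rw [mulVec_diagonal]
    rw [h, scaledProj, ← mulVec_mulVec, ← mulVec_mulVec, diagonal_conjTranspose]
    ext i
    rw [mulVec_diagonal]
    rfl
  rw [h1]
  refine (normSqVec_mul_le (L := L) (fun i => by rw [norm_star]; exact hd i) _).trans ?_
  rw [sq, mul_assoc]
  refine mul_le_mul_of_nonneg_left ?_ hL
  rw [normSqVec_mulVec_of_isStarProjection hP]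
  exact (re_quadForm_le_of_isStarProjection hP _).trans (normSqVec_mul_le hd y)

end Vectors

/-! ### Flat functions, the weighted acceptance matrices and the bound in normal form. -/

namespace Adversary

variable {X Y : Type*} [Fintype X] [DecidableEq X] [Fintype Y]

/-- The amplitudes of the state `V |ψ_h⟩`. -/
noncomputable def amp (A : Adversary X Y) (h : X → ℤˣ) : Y → ℂ := A.V *ᵥ phaseState h

/-- The mean square of an amplitude over uniformly random `h`. -/
noncomputable def weight (A : Adversary X Y) (i : Y) : ℝ :=
  (∑ x, ‖A.V i x‖ ^ 2) / Fintype.card X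

lemma weight_nonneg (A : Adversary X Y) (i : Y) : 0 ≤ A.weight i := by
  unfold weight
  positivity

lemma sum_weight [Nonempty X] (A : Adversary X Y) : ∑ i, A.weight i = 1 := by
  have hc : (Fintype.card X : ℝ) ≠ 0 := by positivity
  simp only [weight]
  rw [← Finset.sum_div, Finset.sum_comm, div_eq_one_iff_eq hc]
  have : ∀ x, ∑ i, ‖A.V i x‖ ^ 2 = 1 := by
    intro x
    have h := congrFun (congrFun A.isometry x) x
    rw [mul_apply, one_apply_eq] at h
    simp only [conjTranspose_apply, RCLike.star_def, Complex.conj_mul'] at h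
    exact_mod_cast h
  simp [this]

/-- All amplitudes exceed their mean squares at most by the factor `L`. -/
def Flat (A : Adversary X Y) (L : ℝ) (h : X → ℤˣ) : Prop :=
  ∀ i, ‖A.amp h i‖ ^ 2 ≤ L * A.weight i

lemma norm_amp_sq (A : Adversary X Y) (h : X → ℤˣ) (i : Y) :
    ‖A.amp h i‖ ^ 2 = ((∑ x, (A.V i x).re * ((h x : ℤ) : ℝ)) ^ 2 +
      (∑ x, (A.V i x).im * ((h x : ℤ) : ℝ)) ^ 2) / Fintype.card X := by
  have e : A.amp h i = ((Real.sqrt (Fintype.card X) : ℝ) : ℂ)⁻¹ *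
      ∑ x, A.V i x * (((h x : ℤ) : ℝ) : ℂ) := by
    simp only [amp, mulVec, dotProduct, phaseState, signC, Finset.mul_sum]
    refine Finset.sum_congr rfl fun x _ => ?_
    push_cast
    ring
  rw [e, norm_mul, mul_pow, norm_inv, Complex.norm_real, Real.norm_eq_abs, inv_pow, sq_abs,
    Real.sq_sqrt (by positivity), ← Complex.normSq_eq_norm_sq, Complex.normSq_apply]
  simp only [Complex.re_sum, Complex.im_sum, Complex.re_mul_ofReal, Complex.im_mul_ofReal]
  ring

/-- If an amplitude is too large, so is its real or its imaginary part relative to its own variance.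
Each of these real Rademacher sums costs $2e^{-L/2}$, and a union bound over the coordinates gives
the factor `Fintype.card Y`. -/
lemma uniformProb_not_flat_le (A : Adversary X Y) {L : ℝ} (hL : 0 ≤ L) :
    uniformProb (fun h => ¬ A.Flat L h) ≤ 4 * Fintype.card Y * Real.exp (-L / 2) := by
  have hi : ∀ i, uniformProb (fun h => ¬ ‖A.amp h i‖ ^ 2 ≤ L * A.weight i) ≤
      4 * Real.exp (-L / 2) := by
    intro i
    have h1 := uniformProb_rademacher_sq_le (fun x => (A.V i x).re) hL
    have h2 := uniformProb_rademacher_sq_le (fun x => (A.V i x).im) hL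
    have h3 := uniformProb_or_le
      (fun h : X → ℤˣ => L * ∑ x, (A.V i x).re ^ 2 < (∑ x, (A.V i x).re * ((h x : ℤ) : ℝ)) ^ 2)
      (fun h : X → ℤˣ => L * ∑ x, (A.V i x).im ^ 2 < (∑ x, (A.V i x).im * ((h x : ℤ) : ℝ)) ^ 2)
    refine (uniformProb_mono fun h hh => ?_).trans (h3.trans (by linarith))
    by_contra! hcon
    refine hh ?_
    rw [norm_amp_sq, weight, mul_div_assoc']
    refine div_le_div_of_nonneg_right ?_ (by positivity)
    have e : ∑ x, ‖A.V i x‖ ^ 2 = ∑ x, (A.V i x).re ^ 2 + ∑ x, (A.V i x).im ^ 2 := by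
      rw [← Finset.sum_add_distrib]
      refine Finset.sum_congr rfl fun x _ => ?_
      rw [← Complex.normSq_eq_norm_sq, Complex.normSq_apply]
      ring
    rw [e, mul_add]
    exact add_le_add hcon.1 hcon.2
  calc _ ≤ uniformProb (fun h => ∃ i, ¬ ‖A.amp h i‖ ^ 2 ≤ L * A.weight i) :=
        uniformProb_mono fun h hh => by simpa [Flat] using hh
    _ ≤ ∑ i, uniformProb (fun h => ¬ ‖A.amp h i‖ ^ 2 ≤ L * A.weight i) :=
        uniformProb_exists_le _
    _ ≤ ∑ _i : Y, 4 * Real.exp (-L / 2) := Finset.sum_le_sum fun i _ => hi i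
    _ = _ := by
        rw [Finset.sum_const, Finset.card_univ, nsmul_eq_mul]
        ring

/-- The unit vector that encodes the oracle `f` in the weighted coordinates. -/
noncomputable def oracleVec (A : Adversary X Y) (f : Y → ℤˣ) : Y → ℂ :=
  fun i => signC (f i) * ((Real.sqrt (A.weight i) : ℝ) : ℂ)

lemma normSqVec_oracleVec [Nonempty X] (A : Adversary X Y) (f : Y → ℤˣ) :
    normSqVec (A.oracleVec f) = 1 := by
  unfold oracleVec
  rw [normSqVec_signC_mul, ← A.sum_weight]
  refine Finset.sum_congr rfl fun i _ => ?_
  rw [Complex.norm_real, Real.norm_eq_abs, sq_abs, Real.sq_sqrt (A.weight_nonneg i)]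

variable [DecidableEq Y]

lemma acceptProb_eq (A : Adversary X Y) (f : Y → ℤˣ) (h : X → ℤˣ) :
    A.acceptProb f h = (star (fun i => signC (f i) * A.amp h i) ⬝ᵥ
      (A.P *ᵥ (fun i => signC (f i) * A.amp h i))).re := by
  have e : (fun i => signC (f i) * A.amp h i) = phaseOracle f *ᵥ (A.V *ᵥ phaseState h) := by
    ext i
    rw [phaseOracle, mulVec_diagonal, amp]
  have hO : (phaseOracle f)ᴴ = phaseOracle f := by
    rw [phaseOracle, diagonal_conjTranspose]
    congr 1
    ext i
    simp [signC]
  rw [acceptProb, e, star_mulVec, star_mulVec, hO]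
  simp only [← dotProduct_mulVec, mulVec_mulVec, Matrix.mul_assoc]

lemma acceptProb_nonneg (A : Adversary X Y) (f : Y → ℤˣ) (h : X → ℤˣ) :
    0 ≤ A.acceptProb f h := by
  rw [acceptProb_eq, ← normSqVec_mulVec_of_isStarProjection A.projection]
  exact normSqVec_nonneg _

lemma acceptProb_le_one [Nonempty X] (A : Adversary X Y) (f : Y → ℤˣ) (h : X → ℤˣ) :
    A.acceptProb f h ≤ 1 := by
  rw [acceptProb_eq]
  refine (re_quadForm_le_of_isStarProjection A.projection _).trans_eq ?_
  rw [normSqVec_signC_mul, amp, normSqVec_mulVec_of_isometry A.isometry, normSqVec_phaseState]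

open scoped Classical in
/-- The acceptance matrix, normalized by the weights, and replaced by `0` unless `h` is flat. -/
noncomputable def truncMatrix (A : Adversary X Y) (L : ℝ) (h : X → ℤˣ) : Matrix Y Y ℂ :=
  if A.Flat L h then
    scaledProj A.P (fun i => A.amp h i / ((Real.sqrt (A.weight i) : ℝ) : ℂ)) else 0

lemma isHermitian_truncMatrix (A : Adversary X Y) (L : ℝ) (h : X → ℤˣ) :
    (A.truncMatrix L h).IsHermitian := by
  unfold truncMatrix
  split_ifs
  · exact isHermitian_scaledProj A.projection _
  · exact isHermitian_zero

lemma normSqVec_truncMatrix_mulVec_le (A : Adversary X Y) {L : ℝ} (hL : 0 ≤ L) (h : X → ℤˣ)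
    (y : Y → ℂ) : normSqVec (A.truncMatrix L h *ᵥ y) ≤ L ^ 2 * normSqVec y := by
  unfold truncMatrix
  split_ifs with hh
  · refine normSqVec_scaledProj_mulVec_le A.projection hL (fun i => ?_) y
    rw [norm_div, Complex.norm_real, Real.norm_eq_abs, div_pow, sq_abs,
      Real.sq_sqrt (A.weight_nonneg i)]
    exact div_le_of_le_mul₀ (A.weight_nonneg i) hL (hh i)
  · rw [zero_mulVec]
    simpa [normSqVec] using mul_nonneg (sq_nonneg L) (normSqVec_nonneg y)

-- The weights in `oracleVec` cancel those in `truncMatrix`, so the matrix no longer involves $f$.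
open scoped Classical in
lemma quadForm_truncMatrix (A : Adversary X Y) {L : ℝ} (f : Y → ℤˣ) (h : X → ℤˣ) :
    (star (A.oracleVec f) ⬝ᵥ (A.truncMatrix L h *ᵥ A.oracleVec f)).re =
      if A.Flat L h then A.acceptProb f h else 0 := by
  unfold truncMatrix
  split_ifs with hh
  · rw [quadForm_scaledProj, acceptProb_eq]
    have e : (fun i => A.amp h i / ((Real.sqrt (A.weight i) : ℝ) : ℂ) * A.oracleVec f i) =
        fun i => signC (f i) * A.amp h i := by
      ext i
      unfold oracleVec
      -- At weight zero the quotient is 0 by convention; this is harmless, since flatness forces the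
      -- amplitude to vanish.
      rcases (A.weight_nonneg i).eq_or_lt' with h0 | h0
      · have h1 := hh i
        rw [h0, mul_zero] at h1
        have h2 : A.amp h i = 0 := by
          rw [← norm_eq_zero]
          nlinarith [norm_nonneg (A.amp h i)]
        simp [h2]
      · have h1 : ((Real.sqrt (A.weight i) : ℝ) : ℂ) ≠ 0 := by
          exact_mod_cast (Real.sqrt_pos.2 h0).ne'
        field_simp
    rw [e]
  · simp

/-- The centered truncated acceptance matrix. -/
noncomputable def centeredMatrix (A : Adversary X Y) (L : ℝ) (h : X → ℤˣ) : Matrix Y Y ℂ :=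
  A.truncMatrix L h - ((Fintype.card (X → ℤˣ) : ℝ)⁻¹ : ℝ) • ∑ h', A.truncMatrix L h'

lemma isHermitian_centeredMatrix (A : Adversary X Y) (L : ℝ) (h : X → ℤˣ) :
    (A.centeredMatrix L h).IsHermitian := by
  refine (A.isHermitian_truncMatrix L h).sub ?_
  rw [IsHermitian, conjTranspose_smul, conjTranspose_sum, star_trivial]
  congr 1
  exact Finset.sum_congr rfl fun k _ => (A.isHermitian_truncMatrix L k).eq

lemma sum_centeredMatrix (A : Adversary X Y) (L : ℝ) : ∑ h, A.centeredMatrix L h = 0 := by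
  have hc : (Fintype.card (X → ℤˣ) : ℝ) ≠ 0 := by positivity
  simp only [centeredMatrix, Finset.sum_sub_distrib, Finset.sum_const, Finset.card_univ]
  rw [← Nat.cast_smul_eq_nsmul ℝ, smul_smul, mul_inv_cancel₀ hc, one_smul, sub_self]

/-- The common mean cancels in the difference, so centering does not worsen the constant. -/
lemma normSqVec_centeredMatrix_sub_le (A : Adversary X Y) {L : ℝ} (hL : 0 ≤ L) (h h' : X → ℤˣ)
    (y : Y → ℂ) : normSqVec ((A.centeredMatrix L h - A.centeredMatrix L h') *ᵥ y) ≤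
      4 * L ^ 2 * normSqVec y := by
  rw [centeredMatrix, centeredMatrix, sub_sub_sub_cancel_right, sub_mulVec]
  have h1 := A.normSqVec_truncMatrix_mulVec_le hL h y
  have h2 := A.normSqVec_truncMatrix_mulVec_le hL h' y
  have h3 := normSqVec_sub_le (A.truncMatrix L h *ᵥ y) (A.truncMatrix L h' *ᵥ y)
  linarith

/-- If all members of the family are flat, the advantage differs from a quadratic form of the
centered matrices at most by the probability that a random function is not flat. -/
lemma advantage_le [Nonempty X] (A : Adversary X Y) {L : ℝ} {K : ℕ} (hK : 0 < K)
    {R : Fin K → X → ℤˣ} (hR : ∀ k, A.Flat L (R k)) (f : Y → ℤˣ) :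
    advantage (A.acceptProb f) R ≤
      |(star (A.oracleVec f) ⬝ᵥ ((∑ k, A.centeredMatrix L (R k)) *ᵥ A.oracleVec f)).re| / K +
        uniformProb (fun h => ¬ A.Flat L h) := by
  classical
  set q : Matrix Y Y ℂ →ₗ[ℝ] ℝ :=
    { toFun := fun M => (star (A.oracleVec f) ⬝ᵥ (M *ᵥ A.oracleVec f)).re
      map_add' := fun M M' => by rw [add_mulVec, dotProduct_add, Complex.add_re]
      map_smul' := fun r M => by
        rw [smul_mulVec, dotProduct_smul, Complex.smul_re, RingHom.id_apply] } with hq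
  have hK' : (K : ℝ) ≠ 0 := by positivity
  set c : ℝ := ↑(Fintype.card (X → ℤˣ)) with hc
  have hc0 : 0 < c := by positivity
  have hqt : ∀ h, q (A.truncMatrix L h) = if A.Flat L h then A.acceptProb f h else 0 :=
    fun h => A.quadForm_truncMatrix f h
  -- The part of the mean acceptance probability that truncation removes. It is the only bias, since
  -- every $R_k$ is flat.
  set b : ℝ := (∑ h, if A.Flat L h then 0 else A.acceptProb f h) / c with hb
  have hb0 : 0 ≤ b := by
    refine div_nonneg (Finset.sum_nonneg fun h _ => ?_) hc0.le
    split_ifs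
    exacts [le_rfl, A.acceptProb_nonneg f h]
  have hb1 : b ≤ uniformProb (fun h => ¬ A.Flat L h) := by
    rw [uniformProb_eq_sum, hb]
    refine div_le_div_of_nonneg_right (Finset.sum_le_sum fun h _ => ?_) hc0.le
    by_cases hh : A.Flat L h <;> simp [hh, A.acceptProb_le_one f h]
  have hqs : q (∑ k, A.centeredMatrix L (R k)) =
      ∑ k, A.acceptProb f (R k) - K * ((∑ h, A.acceptProb f h) / c - b) := by
    have e : (∑ h, A.acceptProb f h) / c - b =
        c⁻¹ * ∑ h, if A.Flat L h then A.acceptProb f h else 0 := by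
      rw [hb, ← sub_div, ← Finset.sum_sub_distrib, div_eq_inv_mul]
      congr 1
      refine Finset.sum_congr rfl fun h _ => ?_
      split_ifs <;> simp
    rw [e]
    have hk : ∀ k, q (A.centeredMatrix L (R k)) = A.acceptProb f (R k) -
        c⁻¹ * ∑ h, if A.Flat L h then A.acceptProb f h else 0 := by
      intro k
      rw [centeredMatrix, map_sub, map_smul, map_sum, hqt, if_pos (hR k), smul_eq_mul]
      simp only [hqt, hc]
    rw [map_sum]
    simp only [hk, Finset.sum_sub_distrib, Finset.sum_const, Finset.card_univ, Fintype.card_fin,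
      nsmul_eq_mul]
  have hadv : advantage (A.acceptProb f) R =
      |q (∑ k, A.centeredMatrix L (R k)) / K - b| := by
    rw [advantage, Fintype.expect_eq_sum_div_card, Fintype.expect_eq_sum_div_card, hqs,
      Fintype.card_fin]
    congr 1
    field_simp
    ring
  rw [hadv]
  refine (abs_sub _ _).trans ?_
  rw [abs_div, Nat.abs_cast, abs_of_nonneg hb0]
  exact add_le_add le_rfl hb1

theorem uniformProb_maxAdvantage_le [Nonempty X] (A : Adversary X Y) {K : ℕ} (hK : 0 < K) :
    uniformProb (fun R : Fin K → X → ℤˣ => A.maxAdvantage R ≥ 1 / (K : ℝ) ^ (1 / 4 : ℝ) +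
        4 * (Fintype.card Y : ℝ) * Real.exp (-(K : ℝ) ^ (1 / 8 : ℝ) / 2)) ≤
      6 * (K : ℝ) * (Fintype.card Y : ℝ) * Real.exp (-(K : ℝ) ^ (1 / 8 : ℝ) / 32) := by
  have hK1 : (1 : ℝ) ≤ K := by exact_mod_cast hK
  -- Flatness level $L=x$ and threshold $x^6$ for the quadratic form: dividing by $K=x^8$ leaves
  -- $x^{-2}=K^{-1/4}$.
  set x : ℝ := (K : ℝ) ^ (1 / 8 : ℝ) with hx
  have hx0 : 0 < x := by positivity
  have hx8 : x ^ 8 = K := by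
    rw [hx, ← Real.rpow_natCast, ← Real.rpow_mul (by positivity)]
    norm_num
  have hx2 : (K : ℝ) ^ (1 / 4 : ℝ) = x ^ 2 := by
    rw [hx, ← Real.rpow_natCast, ← Real.rpow_mul (by positivity)]
    norm_num
  have hY : (1 : ℝ) ≤ Fintype.card Y := by
    have : Nonempty Y := by
      by_contra hne
      rw [not_nonempty_iff] at hne
      simpa using A.sum_weight
    exact_mod_cast Fintype.card_pos (α := Y)
  have hKY : 1 ≤ (K : ℝ) * Fintype.card Y := one_le_mul_of_one_le_of_one_le hK1 hY
  -- For $x<32$ the claimed bound exceeds 1, since $6e^{-1}\ge 2$.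
  rcases lt_or_ge x 32 with hlt | hge
  · refine (uniformProb_le_one _).trans ?_
    have h1 : Real.exp (-1) ≤ Real.exp (-x / 32) := Real.exp_le_exp.2 (by linarith)
    have h2 : 1 / 3 ≤ Real.exp (-1) := by
      have := Real.exp_neg_one_gt_d9
      linarith
    nlinarith
  set M : ℝ := ↑(Fintype.card Y) with hM
  -- With $c=4x^2$ and $t=x^6$ the base of the moment bound is $4p/x^2$. This is at most $e^{-1}$
  -- for $x\ge 32$, so the $p$-th power is at most $e^{-x/32}$.
  set p : ℕ := ⌈x / 32⌉₊ with hp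
  have hp1 : x / 32 ≤ p := Nat.le_ceil _
  have hp2 : (p : ℝ) < x / 32 + 1 := Nat.ceil_lt_add_one (by positivity)
  have hbad := A.uniformProb_not_flat_le hx0.le
  have hflat : uniformProb (fun R : Fin K → X → ℤˣ => ∃ k, ¬ A.Flat x (R k)) ≤
      K * (4 * M * Real.exp (-x / 2)) := by
    refine (uniformProb_exists_le _).trans ?_
    simp only [uniformProb_apply _ (fun h : X → ℤˣ => ¬ A.Flat x h)]
    rw [Finset.sum_const, Finset.card_univ, Fintype.card_fin, nsmul_eq_mul]
    gcongr
  have hconc := uniformProb_quadForm_sum_ge_le (κ := Fin K) (A.isHermitian_centeredMatrix x)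
    (A.sum_centeredMatrix x) (by positivity) (A.normSqVec_centeredMatrix_sub_le hx0.le) p
    (t := x ^ 6) (by positivity)
  have hmom : M * (p * (4 * x ^ 2) * Fintype.card (Fin K) / (x ^ 6) ^ 2) ^ p ≤
      M * Real.exp (-x / 32) := by
    gcongr
    have h1 : p * (4 * x ^ 2) * Fintype.card (Fin K) / (x ^ 6) ^ 2 ≤ Real.exp (-1) := by
      rw [Fintype.card_fin, ← hx8, div_le_iff₀ (by positivity)]
      have := Real.exp_neg_one_gt_d9
      have h2 : p * 4 ≤ Real.exp (-1) * x ^ 2 := by nlinarith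
      calc _ = p * 4 * x ^ 10 := by ring
        _ ≤ Real.exp (-1) * x ^ 2 * x ^ 10 := by gcongr
        _ = _ := by ring
    calc _ ≤ Real.exp (-1) ^ p := by gcongr
      _ = Real.exp (-p) := by rw [← Real.exp_nat_mul, mul_neg_one]
      _ ≤ _ := Real.exp_le_exp.2 (by linarith)
  have hle : Real.exp (-x / 2) ≤ Real.exp (-x / 32) := Real.exp_le_exp.2 (by linarith)
  have hE := Real.exp_pos (-x / 32)
  calc _ ≤ uniformProb (fun R : Fin K → X → ℤˣ => (∃ k, ¬ A.Flat x (R k)) ∨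
          ∃ g, normSqVec g = 1 ∧
            x ^ 6 ≤ |(star g ⬝ᵥ ((∑ k, A.centeredMatrix x (R k)) *ᵥ g)).re|) := by
        refine uniformProb_mono fun R hR => ?_
        by_contra! hcon
        obtain ⟨hR1, hR2⟩ := hcon
        obtain ⟨f, hf⟩ := exists_eq_ciSup_of_finite
          (f := fun f : Y → ℤˣ => advantage (A.acceptProb f) R)
        have h1 := A.advantage_le hK hR1 f
        have h2 := hR2 _ (A.normSqVec_oracleVec f)
        rw [maxAdvantage, ← hf, hx2] at hR
        have h3 : |(star (A.oracleVec f) ⬝ᵥ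
            ((∑ k, A.centeredMatrix x (R k)) *ᵥ A.oracleVec f)).re| / K < 1 / x ^ 2 := by
          rw [← hx8, div_lt_div_iff₀ (by positivity) (by positivity)]
          calc _ < x ^ 6 * x ^ 2 := by gcongr
            _ = _ := by ring
        linarith
    _ ≤ K * (4 * M * Real.exp (-x / 2)) + M * Real.exp (-x / 32) :=
        (uniformProb_or_le _ _).trans (add_le_add hflat (hconc.trans hmom))
    _ ≤ K * (4 * M * Real.exp (-x / 32)) + K * M * Real.exp (-x / 32) := by
        refine add_le_add (by gcongr) (mul_le_mul_of_nonneg_right ?_ hE.le)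
        exact le_mul_of_one_le_left (by positivity) hK1
    _ ≤ _ := by nlinarith [mul_pos (mul_pos (zero_lt_one.trans_le hK1) (zero_lt_one.trans_le hY)) hE]

end Adversary

/-! ### Reduction of circuits to the normal form. -/

namespace OneQueryCircuit

variable {n m l : ℕ}

/-- The bit string `x` padded with zeros. -/
def padBits (m : ℕ) (x : Fin n → Bool) : Fin m → Bool :=
  fun i => if h : (i : ℕ) < n then x ⟨i, h⟩ else false

lemma firstBits_padBits (hnm : n ≤ m) (x : Fin n → Bool) :
    firstBits hnm (padBits m x) = x := by
  ext i
  simp [firstBits, padBits]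

lemma padBits_firstBits (hnm : n ≤ m) {z : Fin m → Bool}
    (hz : ∀ i : Fin m, n ≤ (i : ℕ) → z i = false) : padBits m (firstBits hnm z) = z := by
  ext i
  by_cases h : (i : ℕ) < n
  · simp [firstBits, padBits, h]
  · simp [padBits, h, hz i (not_lt.1 h)]

/-- The isometry `|ψ⟩ ↦ |ψ⟩ ⊗ |0^{m-n}⟩`. -/
def ancillaMatrix (n m : ℕ) : Matrix (Fin m → Bool) (Fin n → Bool) ℂ :=
  Matrix.of fun z x => if z = padBits m x then 1 else 0

lemma ancillaMatrix_isometry (hnm : n ≤ m) : (ancillaMatrix n m)ᴴ * ancillaMatrix n m = 1 := by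
  have hinj : Function.Injective (padBits (n := n) m) :=
    Function.LeftInverse.injective (firstBits_padBits hnm)
  ext x y
  simp [mul_apply, ancillaMatrix, one_apply, hinj.eq_iff, eq_comm]

lemma ancillaMatrix_mulVec (A : OneQueryCircuit n m l) (ψ : (Fin n → Bool) → ℂ) :
    ancillaMatrix n m *ᵥ ψ = A.withAncilla ψ := by
  ext z
  simp only [mulVec, dotProduct, ancillaMatrix, of_apply, withAncilla, ite_mul, one_mul, zero_mul]
  split_ifs with hz
  · rw [Finset.sum_eq_single (firstBits A.input_le z)]
    · rw [padBits_firstBits A.input_le hz, if_pos rfl]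
    · intro x _ hx
      refine if_neg fun h => hx ?_
      rw [h, firstBits_padBits]
    · simp
  · refine Finset.sum_eq_zero fun x _ => if_neg fun h => hz fun i hi => ?_
    simp [h, padBits, not_lt.2 hi]

/-- The projection onto the first qubit being `0`. -/
def outputProj (hm : 0 < m) : Matrix (Fin m → Bool) (Fin m → Bool) ℂ :=
  diagonal fun z => if z ⟨0, hm⟩ = false then 1 else 0

/-- The normal form of a one-query oracle circuit. -/
def toAdversary (A : OneQueryCircuit n m l) : Adversary (Fin n → Bool) (Fin m → Bool) where
  V := A.U₁ * ancillaMatrix n m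
  isometry := by
    have h : A.U₁ᴴ * A.U₁ = 1 := mem_unitaryGroup_iff'.1 A.U₁_unitary
    rw [conjTranspose_mul, Matrix.mul_assoc, ← Matrix.mul_assoc A.U₁ᴴ, h, Matrix.one_mul,
      ancillaMatrix_isometry A.input_le]
  P := A.U₂ᴴ * (outputProj A.pos * A.U₂)
  projection := by
    have h : A.U₂ * A.U₂ᴴ = 1 := mem_unitaryGroup_iff.1 A.U₂_unitary
    have h1 : outputProj A.pos * outputProj A.pos = outputProj A.pos := by
      simp [outputProj]
    have h2 : (outputProj A.pos)ᴴ = outputProj A.pos := by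
      rw [outputProj, diagonal_conjTranspose]
      congr 1
      ext z
      simp [apply_ite]
    constructor
    · rw [IsIdempotentElem, Matrix.mul_assoc A.U₂ᴴ, Matrix.mul_assoc (outputProj A.pos),
        ← Matrix.mul_assoc A.U₂, h, Matrix.one_mul, ← Matrix.mul_assoc (outputProj A.pos), h1]
    · rw [IsSelfAdjoint, star_eq_conjTranspose, conjTranspose_mul, conjTranspose_mul,
        conjTranspose_conjTranspose, h2, Matrix.mul_assoc]

lemma acceptProb_toAdversary (A : OneQueryCircuit n m l) (f : (Fin l → Bool) → ℤˣ)
    (h : (Fin n → Bool) → ℤˣ) :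
    A.toAdversary.acceptProb (fun z => f (firstBits A.query_le z)) h = A.acceptProb f h := by
  rw [Adversary.acceptProb_eq]
  have e : (fun z => signC (f (firstBits A.query_le z)) * A.toAdversary.amp h z) =
      phaseOracle (fun z => f (firstBits A.query_le z)) *ᵥ
        (A.U₁ *ᵥ A.withAncilla (phaseState h)) := by
    ext z
    rw [phaseOracle, mulVec_diagonal, ← ancillaMatrix_mulVec, mulVec_mulVec]
    rfl
  rw [e]
  simp only [toAdversary, ← mulVec_mulVec]
  rw [dotProduct_mulVec, ← star_mulVec]
  simp only [acceptProb, finalState, outputProj, dotProduct, mulVec_diagonal, Complex.re_sum,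
    Pi.star_apply, RCLike.star_def]
  refine Finset.sum_congr rfl fun z _ => ?_
  split_ifs
  · rw [one_mul, Complex.conj_mul', ← Complex.ofReal_pow, Complex.ofReal_re]
  · simp

/-- An oracle on $\ell$ qubits is an oracle on all $m$ qubits that ignores the remaining bits, so
the normal form maximizes over a larger set. -/
lemma maxAdvantage_le_toAdversary (A : OneQueryCircuit n m l) {K : ℕ}
    (R : Fin K → (Fin n → Bool) → ℤˣ) : A.maxAdvantage R ≤ A.toAdversary.maxAdvantage R := by
  refine ciSup_le fun f => ?_
  have h := le_ciSup (Set.finite_range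
    (fun f : (Fin m → Bool) → ℤˣ => advantage (A.toAdversary.acceptProb f) R)).bddAbove
    (fun z => f (firstBits A.query_le z))
  rwa [show A.toAdversary.acceptProb (fun z => f (firstBits A.query_le z)) = A.acceptProb f from
    funext (A.acceptProb_toAdversary f)] at h

end OneQueryCircuit

end OracleGame

theorem mainTheorem6 :
    (∀ (K N M : ℕ), 0 < K → 0 < N → ∀ A : OracleGame.Adversary (Fin N) (Fin M),
      OracleGame.uniformProb (fun R : Fin K → Fin N → ℤˣ =>
          A.maxAdvantage R ≥ 1 / (K : ℝ) ^ (1 / 4 : ℝ)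
            + 4 * (M : ℝ) * Real.exp (-(K : ℝ) ^ (1 / 8 : ℝ) / 2))
        ≤ 6 * (K : ℝ) * (M : ℝ) * Real.exp (-(K : ℝ) ^ (1 / 8 : ℝ) / 32)) ∧
    (∀ (K n m l : ℕ), 0 < K → ∀ A : OracleGame.OneQueryCircuit n m l,
      OracleGame.uniformProb (fun R : Fin K → (Fin n → Bool) → ℤˣ =>
          A.maxAdvantage R ≥ 1 / (K : ℝ) ^ (1 / 4 : ℝ)
            + 4 * (2 : ℝ) ^ m * Real.exp (-(K : ℝ) ^ (1 / 8 : ℝ) / 2))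
        ≤ 6 * (K : ℝ) * (2 : ℝ) ^ m * Real.exp (-(K : ℝ) ^ (1 / 8 : ℝ) / 32)) := by
  refine ⟨fun K N M hK hN A => ?_, fun K n m l hK A => ?_⟩
  · have : Nonempty (Fin N) := ⟨⟨0, hN⟩⟩
    simpa using A.uniformProb_maxAdvantage_le hK
  · have h := A.toAdversary.uniformProb_maxAdvantage_le hK
    have hc : (Fintype.card (Fin m → Bool) : ℝ) = 2 ^ m := by simp
    rw [hc] at h
    exact (OracleGame.uniformProb_mono fun R hR =>
      ge_trans (A.maxAdvantage_le_toAdversary R) hR).trans h
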